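/- For binary strings $x\in\{0,1\}^m$, $y\in\{0,1\}^n$ with $m\le n$, let $\omega_x(y)$ be the number of sets of positions $\pi\subseteq\{1,\dots,n\}$ such that the bits of $y$ at the positions in $\pi$, read in increasing order, form $x$. Let $\Upsilon_{n,x}=\{y\in\{0,1\}^n:\omega_x(y)\ge 1\}$, $\mu_{n,m}=\binom nm 2^{n-m}$, and $$H_n(x)=-\sum_{y\in\Upsilon_{n,x}}\frac{\omega_x(y)}{\mu_{n,m}}\log_2\frac{\omega_x(y)}{\mu_{n,m}} .$$ Write $x=(a;k_1,\dots,k_\ell)$ if $x$ has $\ell$ maximal runs, of lengths $k_1,\dots,k_\ell$ from left to right, and its first bit is $a$. Let $g(x)=(1-a;\,k_1+k_2,k_3,\dots,k_\ell)$ if $\ell>1$, i.e. the first run is flipped and so merged with the second, and $g(x)=x$ if $\ell\le 1$. Let $n\ge 2$ and let $x$ be a binary string of length $m=n-2$. Then: 1. If $x$ has at least two runs, then $H_n(g(x))<H_n(x)$. 2. For $\sigma=0^m$ and for $\sigma=1^m$, $H_n(x)\ge H_n(\sigma)$, with equality if and only if $x\in\{0^m,1^m\}$. -/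

import Mathlib

/-! Binary strings are lists of Booleans; a string of length exactly `n` whose positions are
selected by masks is a function `Fin n → Bool`. -/

namespace Subseq

/-- The projection `y_π` : the string of the bits of `y` at the positions in `π`, read in increasing
order of position. -/
def project {n : ℕ} (y : Fin n → Bool) (π : Finset (Fin n)) : List Bool :=
  ((List.finRange n).filter (fun i => i ∈ π)).map y

/-- The weight `ω_x(y)`: the number of masks `π ⊆ [n]` with `y_π = x`. -/
def weight {n : ℕ} (x : List Bool) (y : Fin n → Bool) : ℕ :=
  (Finset.univ.filter (fun π : Finset (Fin n) => project y π = x)).card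

/-- The uncertainty set `Υ_{n,x}`: the strings of length `n` that project to `x` for some mask. -/
def uncertaintySet (n : ℕ) (x : List Bool) : Finset (Fin n → Bool) :=
  Finset.univ.filter (fun y => ∃ π : Finset (Fin n), project y π = x)

/-- The total number `μ_{n,m} = C(n,m) 2^(n-m)` of masks (used for `m ≤ n`). -/
def totalMasks (n m : ℕ) : ℕ := n.choose m * 2 ^ (n - m)

/-- `P(Y = y | X = x) = ω_x(y) / μ_{n,m}` where `m` is the length of `x`. -/
noncomputable def prob {n : ℕ} (x : List Bool) (y : Fin n → Bool) : ℝ :=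
  (weight x y : ℝ) / (totalMasks n x.length : ℝ)

/-- The Shannon entropy `H_n(x) = - ∑_{y ∈ Υ_{n,x}} P(y|x) log₂ P(y|x)`. -/
noncomputable def entropy (n : ℕ) (x : List Bool) : ℝ :=
  - ∑ y ∈ uncertaintySet n x, prob x y * Real.logb 2 (prob x y)

/-- The lengths `k₁, …, k_ℓ` of the maximal runs of `x`, from left to right. -/
def runLengths (x : List Bool) : List ℕ :=
  (x.splitBy (fun a b => a == b)).map List.length

/-- The string `(a; k₁, …, k_ℓ)` made of `k₁` copies of `a`, then `k₂` copies of the complement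
of `a`, and so on, alternately. -/
def ofRuns : Bool → List ℕ → List Bool
  | _, [] => []
  | a, k :: ks => List.replicate k a ++ ofRuns (!a) ks

/-- The merging transformation: `(a; k₁, k₂, k₃, …, k_ℓ) ↦ (!a; k₁ + k₂, k₃, …, k_ℓ)` for `ℓ > 1`
(the first run is flipped to its complement); strings with at most one run are fixed. -/
def merge (x : List Bool) : List Bool :=
  match x, runLengths x with
  | a :: _, k₁ :: k₂ :: ks => ofRuns (!a) ((k₁ + k₂) :: ks)
  | _, _ => x

end Subseq

namespace Subseq

/-! Since the weights `ω_x(y)` sum to `μ`, which depends only on `n` and `m`, lower entropy means a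
larger sum of `ω log ω` over `y`, here `logSum 2 x` (`entropy_eq`, `entropy_lt_iff`). Splitting on
the first bit of `y` reduces this sum to single-bit insertions, whose weights are explicit, so
stripping the first run yields the closed form `logSum_two_replicate`. Comparing closed forms before
and after merging leaves three inequalities for `t log t`, all of one kind: by convexity, spreading
two arguments apart at fixed sum increases the total (`xlog_add_lt`, `xlog_add_le`). One of them is
strict, giving `logSum_two_lt_of_merge`. Each merge removes a run, so iteration ends at a constant
string; this proves the second claim. -/

/-- The number of embeddings of the list `x` into the list `y` as a subsequence. -/
def cnt : List Bool → List Bool → ℕ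
  | [], _ => 1
  | _ :: _, [] => 0
  | c :: x, d :: y => cnt (c :: x) y + if c = d then cnt x y else 0

@[simp] lemma cnt_nil_left (y : List Bool) : cnt [] y = 1 := by cases y <;> rfl

@[simp] lemma cnt_cons_nil (c : Bool) (x : List Bool) : cnt (c :: x) [] = 0 := rfl

lemma cnt_cons_cons (c d : Bool) (x y : List Bool) :
    cnt (c :: x) (d :: y) = cnt (c :: x) y + if c = d then cnt x y else 0 := rfl

@[simp] lemma cnt_cons_self (c : Bool) (x y : List Bool) :
    cnt (c :: x) (c :: y) = cnt (c :: x) y + cnt x y := by simp [cnt_cons_cons]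

lemma cnt_le_cnt_cons (x y : List Bool) (d : Bool) : cnt x y ≤ cnt x (d :: y) := by
  cases x with
  | nil => simp
  | cons c x => rw [cnt_cons_cons]; omega

lemma cnt_cons_of_head_ne {x : List Bool} {d : Bool} (h : x.head? ≠ some d) (y : List Bool) :
    cnt x (d :: y) = cnt x y := by
  cases x with
  | nil => simp
  | cons c x =>
    have : c ≠ d := by simpa using h
    simp [cnt_cons_cons, this]

lemma cnt_eq_zero_of_cons_tail {c : Bool} {x y : List Bool} (h : cnt x y = 0) :
    cnt (c :: x) y = 0 := by
  induction y with
  | nil => simp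
  | cons d y ih =>
    have h1 : cnt x y = 0 := Nat.le_zero.1 (h ▸ cnt_le_cnt_cons x y d)
    simp [cnt_cons_cons, ih h1, h1]

lemma cnt_eq_zero_of_length_lt {x y : List Bool} (h : y.length < x.length) : cnt x y = 0 := by
  induction y generalizing x with
  | nil => cases x with
    | nil => simp at h
    | cons c x => simp
  | cons d y ih => cases x with
    | nil => simp at h
    | cons c x =>
      simp only [List.length_cons] at h
      rw [cnt_cons_cons, ih (by simp; omega), ih (by omega)]; simp

lemma cnt_of_length_eq {x y : List Bool} (h : x.length = y.length) :
    cnt x y = if x = y then 1 else 0 := by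
  induction y generalizing x with
  | nil =>
    obtain rfl : x = [] := by simpa using h
    simp
  | cons d y ih => cases x with
    | nil => simp at h
    | cons c x =>
      simp only [List.length_cons, Nat.add_right_cancel_iff] at h
      rw [cnt_cons_cons, cnt_eq_zero_of_length_lt (by simp; omega), ih h]
      by_cases hcd : c = d <;> simp [hcd]

@[simp] lemma cnt_self (x : List Bool) : cnt x x = 1 := by simp [cnt_of_length_eq]

/-! ### Masks and sums over strings -/

/-- Sets of positions in `Fin (n + 1)` are a bit, for the position `0`, and a set in `Fin n`. -/
def finsetSuccEquiv (n : ℕ) : Bool × Finset (Fin n) ≃ Finset (Fin (n + 1)) where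
  toFun p := Finset.univ.filter
    (fun i => (Fin.cases p.1 (fun j => decide (j ∈ p.2)) i : Bool) = true)
  invFun π := (decide (0 ∈ π), Finset.univ.filter (fun j => j.succ ∈ π))
  left_inv p := by ext <;> simp
  right_inv π := by
    ext i
    refine Fin.cases ?_ (fun j => ?_) i <;> simp

lemma project_finsetSuccEquiv {n : ℕ} (y : Fin (n + 1) → Bool) (b : Bool) (π : Finset (Fin n)) :
    project y (finsetSuccEquiv n (b, π)) =
      (if b then [y 0] else []) ++ project (fun i => y i.succ) π := by
  have h : ((List.finRange n).map Fin.succ).filter (fun i => i ∈ finsetSuccEquiv n (b, π)) =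
      ((List.finRange n).filter (fun i => i ∈ π)).map Fin.succ := by
    rw [List.filter_map]
    congr 1
    apply List.filter_congr
    intro i _
    simp [finsetSuccEquiv]
  have h0 : (0 : Fin (n + 1)) ∈ finsetSuccEquiv n (b, π) ↔ b = true := by
    simp [finsetSuccEquiv]
  unfold project
  rw [List.finRange_succ, List.filter_cons, h]
  cases b <;> simp [h0, Function.comp_def]

lemma weight_eq_sum {n : ℕ} (x : List Bool) (y : Fin n → Bool) :
    weight x y = ∑ π : Finset (Fin n), if project y π = x then 1 else 0 := by
  simp [weight]

lemma weight_eq_cnt {n : ℕ} (x : List Bool) (y : Fin n → Bool) :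
    weight x y = cnt x (List.ofFn y) := by
  induction n generalizing x with
  | zero =>
    rw [weight_eq_sum]
    cases x <;> simp [project]
  | succ n ih =>
    have h : weight x y = weight x (fun i => y i.succ) +
        ∑ π : Finset (Fin n), if y 0 :: project (fun i => y i.succ) π = x then 1 else 0 := by
      rw [weight_eq_sum, weight_eq_sum, ← (finsetSuccEquiv n).sum_comp, Fintype.sum_prod_type]
      simp [project_finsetSuccEquiv, add_comm]
    rw [h, ih, List.ofFn_succ]
    cases x with
    | nil => simp
    | cons c x =>
      rw [cnt_cons_cons, ← ih x, weight_eq_sum]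
      by_cases hc : c = y 0
      · simp [hc]
      · simp [hc, Ne.symm hc]

/-- The sum of `φ` over the binary strings of length `n`. -/
def sumStr : ℕ → (List Bool → ℝ) → ℝ
  | 0, φ => φ []
  | n + 1, φ => sumStr n (fun y => φ (true :: y)) + sumStr n (fun y => φ (false :: y))

lemma sum_ofFn (n : ℕ) (φ : List Bool → ℝ) :
    ∑ y : Fin n → Bool, φ (List.ofFn y) = sumStr n φ := by
  induction n generalizing φ with
  | zero => simp [sumStr]
  | succ n ih =>
    rw [← (Fin.consEquiv (fun _ => Bool)).sum_comp, Fintype.sum_prod_type]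
    simp [sumStr, ← ih, List.ofFn_succ, Fin.consEquiv]

lemma sumStr_succ (c : Bool) (n : ℕ) (φ : List Bool → ℝ) :
    sumStr (n + 1) φ = sumStr n (fun y => φ (c :: y)) + sumStr n (fun y => φ ((!c) :: y)) := by
  cases c
  · rw [sumStr, add_comm]; rfl
  · rfl

lemma sumStr_congr {n : ℕ} {φ ψ : List Bool → ℝ} (h : ∀ y, y.length = n → φ y = ψ y) :
    sumStr n φ = sumStr n ψ := by
  induction n generalizing φ ψ with
  | zero => exact h [] rfl
  | succ n ih =>
    rw [sumStr, sumStr, ih (fun y hy => h _ (by simp [hy])), ih (fun y hy => h _ (by simp [hy]))]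

lemma sumStr_add (n : ℕ) (φ ψ : List Bool → ℝ) :
    sumStr n (fun y => φ y + ψ y) = sumStr n φ + sumStr n ψ := by
  simp_rw [← sum_ofFn, Finset.sum_add_distrib]

lemma sumStr_sub (n : ℕ) (φ ψ : List Bool → ℝ) :
    sumStr n (fun y => φ y - ψ y) = sumStr n φ - sumStr n ψ := by
  simp_rw [← sum_ofFn, Finset.sum_sub_distrib]

lemma sumStr_mul (n : ℕ) (φ : List Bool → ℝ) (r : ℝ) :
    sumStr n (fun y => φ y * r) = sumStr n φ * r := by
  simp_rw [← sum_ofFn, Finset.sum_mul]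

lemma sumStr_eq_single (z : List Bool) {φ : List Bool → ℝ}
    (h : ∀ y, y.length = z.length → cnt z y = 0 → φ y = 0) : sumStr z.length φ = φ z := by
  have h0 : ∀ y : Fin z.length → Bool, y ≠ z.get → φ (List.ofFn y) = 0 := by
    intro y hy
    apply h _ (by simp)
    rw [cnt_of_length_eq (by simp), if_neg]
    intro he
    apply hy
    apply List.ofFn_injective
    rw [← he, List.ofFn_get]
  rw [← sum_ofFn, Finset.sum_eq_single z.get (fun y _ => h0 y) (by simp), List.ofFn_get]

/-- Pascal's rule on the first bit; the factor `2 ^ x.length` avoids truncated subtraction in the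
exponent. -/
lemma sumStr_cnt (n : ℕ) (x : List Bool) :
    2 ^ x.length * sumStr n (fun y => (cnt x y : ℝ)) = n.choose x.length * 2 ^ n := by
  induction n generalizing x with
  | zero => cases x <;> simp [sumStr]
  | succ n ih => cases x with
    | nil =>
      have := ih []
      simp only [List.length_nil, pow_zero, cnt_nil_left, Nat.choose_zero_right] at this ⊢
      rw [sumStr, pow_succ]
      linarith
    | cons c x =>
      have h1 := ih (c :: x)
      have h2 := ih x
      rw [sumStr_succ c]
      have : ∀ y, cnt (c :: x) ((!c) :: y) = cnt (c :: x) y := by simp [cnt_cons_cons]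
      simp only [this, cnt_cons_self, Nat.cast_add, sumStr_add, List.length_cons,
        Nat.choose_succ_succ] at h1 h2 ⊢
      rw [pow_succ, pow_succ] at *
      linear_combination 2 * h1 + 2 * h2

/-! ### Single-bit insertions -/

/-- The sum of `φ` over the distinct strings obtained from `z` by inserting one bit. -/
def insSum (φ : List Bool → ℝ) : List Bool → ℝ
  | [] => φ [true] + φ [false]
  | c :: x => φ ((!c) :: c :: x) + insSum (fun y => φ (c :: y)) x

/-- Each supersequence arises exactly once if the inserted bit must differ from the bit it precedes,
with both bits allowed at the end. -/
lemma sumStr_eq_insSum (z : List Bool) {φ : List Bool → ℝ}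
    (h : ∀ y, y.length = z.length + 1 → cnt z y = 0 → φ y = 0) :
    sumStr (z.length + 1) φ = insSum φ z := by
  induction z generalizing φ with
  | nil => simp [sumStr, insSum]
  | cons c x ih =>
    rw [sumStr_succ c, insSum, add_comm]
    congr 1
    · exact sumStr_eq_single (c :: x) (fun y hy h0 => h _ (by simp [hy])
        (by simpa [cnt_cons_cons] using h0))
    · exact ih (fun y hy h0 => h _ (by simp [hy])
        (by simp [h0, cnt_eq_zero_of_cons_tail h0]))

/-- As `t` does not start with `c`, its only one-bit extension starting with `c` is `c :: t`; the
other extensions start with `!c`. -/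
lemma insSum_congr_of_head {c : Bool} {t : List Bool} (ht : t.head? ≠ some c)
    {φ ψ : List Bool → ℝ}
    (h : ∀ u, u.length = t.length → φ ((!c) :: u) = ψ ((!c) :: u)) :
    insSum φ t - φ (c :: t) = insSum ψ t - ψ (c :: t) := by
  have aux : ∀ (t : List Bool) {φ ψ : List Bool → ℝ},
      (∀ u, u.length = t.length + 1 → φ u = ψ u) → insSum φ t = insSum ψ t := by
    intro t
    induction t with
    | nil => intro φ ψ h; simp [insSum, h]
    | cons d t ih =>
      intro φ ψ h
      rw [insSum, insSum, h _ (by simp), ih (fun u hu => h _ (by simp [hu]))]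
  cases t with
  | nil =>
    have := h [] rfl
    cases c <;> simp [insSum] at this ⊢ <;> linarith
  | cons d t =>
    obtain rfl : d = !c := by cases c <;> cases d <;> simp at ht ⊢
    simp only [insSum, Bool.not_not, add_sub_cancel_left]
    exact aux t (fun u hu => h u (by simp [hu]))

lemma insSum_replicate_append (φ : List Bool → ℝ) (c : Bool) (k : ℕ) (t : List Bool) :
    insSum φ (List.replicate k c ++ t) =
      ∑ j ∈ Finset.range k,
        φ (List.replicate j c ++ (!c) :: (List.replicate (k - j) c ++ t)) +
      insSum (fun y => φ (List.replicate k c ++ y)) t := by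
  induction k generalizing φ with
  | zero => simp
  | succ k ih =>
    rw [List.replicate_succ, List.cons_append, insSum, ih, Finset.sum_range_succ']
    simp only [Nat.succ_sub_succ, List.replicate_succ, List.cons_append, List.replicate_zero,
      List.nil_append, Nat.sub_zero]
    ring

/-! ### Weights of extensions of a string with a known first run -/

lemma cnt_replicate_succ {c : Bool} {t : List Bool} (ht : t.head? ≠ some c) (k : ℕ) :
    cnt (List.replicate k c ++ t) (List.replicate (k + 1) c ++ t) = k + 1 := by
  induction k with
  | zero => simp [cnt_cons_of_head_ne ht]
  | succ k ih =>
    rw [List.replicate_succ (n := k + 1), List.cons_append]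
    nth_rw 1 [List.replicate_succ, List.cons_append]
    rw [cnt_cons_self, ih, ← List.cons_append, ← List.replicate_succ, cnt_self, add_comm]

lemma cnt_replicate_add_two {c : Bool} {t : List Bool} (ht : t.head? ≠ some c) (k : ℕ) :
    cnt (List.replicate k c ++ t) (List.replicate (k + 2) c ++ t) = (k + 2).choose 2 := by
  induction k with
  | zero => simp [List.replicate_succ, cnt_cons_of_head_ne ht]
  | succ k ih =>
    rw [List.replicate_succ (n := k + 2), List.cons_append]
    nth_rw 1 [List.replicate_succ, List.cons_append]
    rw [cnt_cons_self, ih, ← List.cons_append, ← List.replicate_succ,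
      cnt_replicate_succ ht (k + 1), Nat.choose_succ_succ' (k + 2) 1, Nat.choose_one_right]

lemma cnt_replicate_append_not (c : Bool) {t u : List Bool} (hu : u.length = t.length) (k : ℕ) :
    cnt (List.replicate k c ++ t) (List.replicate k c ++ (!c) :: u) = cnt t ((!c) :: u) := by
  induction k with
  | zero => simp
  | succ k ih =>
    simp only [List.replicate_succ, List.cons_append, cnt_cons_self, ih]
    rw [cnt_of_length_eq (by simp [hu]; omega), if_neg, zero_add]
    rw [← List.cons_append, ← List.replicate_succ, List.replicate_succ', List.append_assoc,
      List.append_right_inj]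
    simp

lemma cnt_replicate_succ_append_not {c : Bool} {t u : List Bool} (ht : t.head? ≠ some c)
    (hu : u.length = t.length) (k : ℕ) :
    cnt (List.replicate k c ++ t) (List.replicate (k + 1) c ++ (!c) :: u) =
      (k + 1) * cnt t ((!c) :: u) := by
  induction k with
  | zero => simp [cnt_cons_of_head_ne ht]
  | succ k ih =>
    rw [List.replicate_succ (n := k + 1), List.cons_append]
    nth_rw 1 [List.replicate_succ, List.cons_append]
    rw [cnt_cons_self, ih, ← List.cons_append, ← List.replicate_succ,
      cnt_replicate_append_not c hu]
    ring

lemma cnt_insert_not_of_replicate (c : Bool) (t : List Bool) (j d : ℕ) :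
    cnt (List.replicate (j + d + 1) c ++ t)
      (List.replicate j c ++ (!c) :: (List.replicate (d + 1) c ++ t)) = 1 := by
  induction j with
  | zero => simp [List.replicate_succ, cnt_cons_cons]
  | succ j ih =>
    rw [show j + 1 + d + 1 = (j + d + 1) + 1 by ring, List.replicate_succ, List.cons_append,
      List.replicate_succ (n := j), List.cons_append, cnt_cons_self, ih,
      cnt_of_length_eq (by simp; omega), if_neg, zero_add]
    rw [← List.cons_append, ← List.replicate_succ,
      show j + d + 1 + 1 = j + ((d + 1) + 1) by ring, List.replicate_add, List.append_assoc,
      List.append_right_inj]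
    simp [List.replicate_succ]

lemma cnt_insert_not_of_replicate_pred (c : Bool) (t : List Bool) (j d : ℕ) :
    cnt (List.replicate (j + d) c ++ t)
      (List.replicate j c ++ (!c) :: (List.replicate (d + 1) c ++ t)) =
      j + cnt (List.replicate d c ++ t) ((!c) :: (List.replicate (d + 1) c ++ t)) := by
  induction j with
  | zero => simp
  | succ j ih =>
    rw [show j + 1 + d = (j + d) + 1 by ring, List.replicate_succ, List.cons_append,
      List.replicate_succ (n := j), List.cons_append, cnt_cons_self, ih,
      ← List.cons_append, ← List.replicate_succ, cnt_insert_not_of_replicate]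
    ring

/-- The number of embeddings of `t` into `(!c) c t`. -/
def chain (c : Bool) (t : List Bool) : ℕ := cnt t ((!c) :: c :: t)

lemma one_le_chain (c : Bool) (t : List Bool) : 1 ≤ chain c t :=
  (cnt_self t).symm.le.trans ((cnt_le_cnt_cons _ _ _).trans (cnt_le_cnt_cons _ _ _))

/-- The case `d = 0` is special: the inserted `!c` then precedes the last `c` of the run, and may
itself serve as the first bit of `t`. -/
lemma cnt_insert_not {c : Bool} {t : List Bool} (ht : t.head? ≠ some c) (j d : ℕ) :
    cnt (List.replicate (j + d) c ++ t)
      (List.replicate j c ++ (!c) :: (List.replicate (d + 1) c ++ t)) =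
      if d = 0 then j + chain c t else j + d + 1 := by
  rw [cnt_insert_not_of_replicate_pred]
  cases d with
  | zero => simp [chain]
  | succ d =>
    rw [cnt_cons_of_head_ne (by simp [List.replicate_succ]), cnt_replicate_succ ht]
    simp [add_assoc]

lemma chain_le {c : Bool} {t : List Bool} (ht : t.head? ≠ some (!c)) (b : ℕ) :
    chain c (List.replicate (b + 1) (!c) ++ t) ≤ b + 1 + chain (!c) t := by
  rw [chain, List.replicate_succ, List.cons_append, cnt_cons_self,
    cnt_cons_of_head_ne (by simp), cnt_self]
  cases b with
  | zero => simp [chain]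
  | succ b =>
    rw [cnt_cons_of_head_ne (by simp [List.replicate_succ]), ← List.cons_append,
      ← List.replicate_succ, cnt_replicate_succ ht]
    have := one_le_chain (!c) t
    omega

/-! ### Convexity of `t log t` -/

/-- The function `t log t`. -/
noncomputable def xlog (t : ℝ) : ℝ := t * Real.log t

@[simp] lemma xlog_zero : xlog 0 = 0 := by simp [xlog]

@[simp] lemma xlog_one : xlog 1 = 0 := by simp [xlog]

lemma xlog_mul {u : ℝ} (hu : u ≠ 0) (v : ℝ) : xlog (u * v) = u * xlog v + v * xlog u := by
  rcases eq_or_ne v 0 with rfl | hv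
  · simp
  · rw [xlog, Real.log_mul hu hv, xlog, xlog]; ring

lemma xlog_add_lt {u v p : ℝ} (hp : 0 ≤ p) (hu : p < u) (hv : p < v) :
    xlog u + xlog v < xlog (u + v - p) + xlog p := by
  have h := Real.strictConvexOn_mul_log.2 (x := p) (y := u + v - p) (Set.mem_Ici.2 hp)
    (Set.mem_Ici.2 (by linarith)) (by intro h; linarith)
  have hd : 0 < u + v - 2 * p := by linarith
  -- `r` is the position of `u` between the endpoints `p` and `u + v - p`; `v` is its mirror image.
  obtain ⟨r, hr⟩ : ∃ r, r = (u - p) / (u + v - 2 * p) := ⟨_, rfl⟩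
  have hr0 : 0 < r := hr ▸ div_pos (by linarith) hd
  have hr1 : r < 1 := by rw [hr, div_lt_one hd]; linarith
  rw [eq_div_iff hd.ne'] at hr
  have h1 := h (a := 1 - r) (b := r) (by linarith) hr0 (by ring)
  have h2 := h (a := r) (b := 1 - r) hr0 (by linarith) (by ring)
  simp only [smul_eq_mul] at h1 h2
  rw [show (1 - r) * p + r * (u + v - p) = u by linear_combination hr] at h1
  rw [show r * p + (1 - r) * (u + v - p) = v by linear_combination -hr] at h2
  simp only [xlog]
  linarith

lemma xlog_add_le {u v p : ℝ} (hp : 0 ≤ p) (hu : p ≤ u) (hv : p ≤ v) :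
    xlog u + xlog v ≤ xlog (u + v - p) + xlog p := by
  rcases hu.eq_or_lt with rfl | hu
  · simp [add_comm]
  rcases hv.eq_or_lt with rfl | hv
  · simp
  exact (xlog_add_lt hp hu hv).le

/-! ### Closed forms for the logarithmic sums -/

/-- The sum of `ω log ω` over the weights `ω` of the strings with `j` more bits than `x`. -/
noncomputable def logSum (j : ℕ) (x : List Bool) : ℝ :=
  sumStr (x.length + j) (fun y => xlog (cnt x y))

lemma logSum_one_eq (x : List Bool) : logSum 1 x = insSum (fun y => xlog (cnt x y)) x :=
  sumStr_eq_insSum x (fun y _ h => by simp [h])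

lemma insSum_cnt (x : List Bool) : insSum (fun y => (cnt x y : ℝ)) x = 2 * (x.length + 1) := by
  rw [← sumStr_eq_insSum x (fun y _ h => by simp [h])]
  have h := sumStr_cnt (x.length + 1) x
  rw [Nat.choose_succ_self_right, pow_succ] at h
  have h2 : (2 : ℝ) ^ x.length ≠ 0 := by positivity
  apply mul_left_cancel₀ h2
  rw [h]; push_cast; ring

/-- Split on the first bit of the longer string. Subtracting `xlog (cnt z y)` makes the remainder
vanish unless `c :: z` embeds in `y`, so only one-bit insertions contribute. -/
lemma logSum_two_cons (c : Bool) (z : List Bool) :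
    logSum 2 (c :: z) = logSum 1 (c :: z) + logSum 2 z +
      insSum (fun y => xlog (cnt (c :: z) (c :: y)) - xlog (cnt z y)) (c :: z) := by
  rw [← sumStr_eq_insSum (c :: z), sumStr_sub, logSum, logSum, logSum]
  · rw [List.length_cons, sumStr_succ c]
    have : ∀ y, cnt (c :: z) ((!c) :: y) = cnt (c :: z) y := by simp [cnt_cons_cons]
    simp only [this, show z.length + 1 + 1 = z.length + 2 by ring]
    ring
  · intro y _ h
    simp [h]

lemma insSum_add_mul (φ ψ : List Bool → ℝ) (r s : ℝ) (t : List Bool) :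
    insSum (fun y => r * φ y + s * ψ y) t = r * insSum φ t + s * insSum ψ t := by
  induction t generalizing φ ψ with
  | nil => simp only [insSum]; ring
  | cons c t ih => simp only [insSum, ih]; ring

lemma logSum_one_replicate {c : Bool} {t : List Bool} (ht : t.head? ≠ some c) (k : ℕ) :
    logSum 1 (List.replicate k c ++ t) = logSum 1 t + xlog (k + 1) := by
  rw [logSum_one_eq, insSum_replicate_append, logSum_one_eq]
  have h1 : ∀ j ∈ Finset.range k, xlog (cnt (List.replicate k c ++ t)
      (List.replicate j c ++ (!c) :: (List.replicate (k - j) c ++ t))) = 0 := by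
    intro j hj
    obtain ⟨d, rfl⟩ := Nat.exists_eq_add_of_lt (Finset.mem_range.1 hj)
    rw [show j + d + 1 - j = d + 1 by omega, cnt_insert_not_of_replicate]
    simp
  have h2 := insSum_congr_of_head ht
    (φ := fun y => xlog (cnt (List.replicate k c ++ t) (List.replicate k c ++ y)))
    (ψ := fun y => xlog (cnt t y)) (by
      intro u hu
      simp only [cnt_replicate_append_not c hu])
  have h3 : List.replicate k c ++ c :: t = List.replicate (k + 1) c ++ t := by
    rw [List.replicate_succ', List.append_assoc]; rfl
  simp only [h3, cnt_replicate_succ ht, cnt_cons_of_head_ne ht, cnt_self, Nat.cast_one,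
    xlog_one] at h2
  push_cast at h2
  rw [Finset.sum_eq_zero h1]
  linarith

lemma logSum_two_replicate_succ {c : Bool} {t : List Bool} (ht : t.head? ≠ some c) (k : ℕ) :
    logSum 2 (List.replicate (k + 1) c ++ t) = logSum 2 (List.replicate k c ++ t) +
      2 * logSum 1 t + xlog (k + 2) + k * (xlog (k + 2) - xlog (k + 1)) +
      (xlog (k + 1 + chain c t) - xlog (k + chain c t)) +
      (xlog ((k + 3).choose 2) - xlog ((k + 2).choose 2)) +
      (2 * t.length + 1) * (xlog (k + 2) - xlog (k + 1)) := by
  rw [List.replicate_succ, List.cons_append, logSum_two_cons, ← List.cons_append,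
    ← List.replicate_succ, logSum_one_replicate ht, insSum_replicate_append,
    Finset.sum_range_succ]
  have h1 : ∀ j ≤ k, (cnt (List.replicate (k + 1) c ++ t)
      (c :: (List.replicate j c ++ (!c) :: (List.replicate (k + 1 - j) c ++ t))) =
        if j = k then k + 1 + chain c t else k + 2) ∧ cnt (List.replicate k c ++ t)
      (List.replicate j c ++ (!c) :: (List.replicate (k + 1 - j) c ++ t)) =
        if j = k then k + chain c t else k + 1 := by
    intro j hj
    obtain ⟨d, rfl⟩ := Nat.exists_eq_add_of_le hj
    rw [show j + d + 1 - j = d + 1 by omega, ← List.cons_append, ← List.replicate_succ,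
      show j + d + 1 = (j + 1) + d by ring, cnt_insert_not ht, cnt_insert_not ht]
    rcases eq_or_ne d 0 with rfl | hd
    · simp
    · simp [hd]; omega
  have h2 : ∀ j ∈ Finset.range k, xlog (cnt (List.replicate (k + 1) c ++ t)
      (c :: (List.replicate j c ++ (!c) :: (List.replicate (k + 1 - j) c ++ t)))) -
      xlog (cnt (List.replicate k c ++ t)
      (List.replicate j c ++ (!c) :: (List.replicate (k + 1 - j) c ++ t))) =
      xlog (k + 2) - xlog (k + 1) := by
    intro j hj
    have hj := Finset.mem_range.1 hj
    rw [(h1 j hj.le).1, (h1 j hj.le).2, if_neg hj.ne, if_neg hj.ne]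
    push_cast
    rfl
  rw [Finset.sum_congr rfl h2, (h1 k le_rfl).1, (h1 k le_rfl).2, if_pos rfl, if_pos rfl]
  have h3 := insSum_congr_of_head ht
    (φ := fun y => xlog (cnt (List.replicate (k + 1) c ++ t) (c :: (List.replicate (k + 1) c ++ y)))
      - xlog (cnt (List.replicate k c ++ t) (List.replicate (k + 1) c ++ y)))
    -- By `xlog_mul`, `xlog ((k+2)w) - xlog ((k+1)w)` is `xlog w` plus a multiple of `w`; the linear
    -- part is then summed by `insSum_cnt`.
    (ψ := fun y => 1 * xlog (cnt t y) + (xlog (k + 2) - xlog (k + 1)) * (cnt t y : ℝ)) (by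
      intro u hu
      simp only [← List.cons_append, ← List.replicate_succ,
        cnt_replicate_succ_append_not ht hu]
      push_cast
      rw [xlog_mul (by positivity), xlog_mul (by positivity)]
      ring_nf)
  have h4 : List.replicate (k + 1) c ++ c :: t = List.replicate (k + 2) c ++ t := by
    rw [List.replicate_succ' (n := k + 1), List.append_assoc]; rfl
  rw [insSum_add_mul, insSum_cnt, ← logSum_one_eq] at h3
  simp only [h4, cnt_replicate_add_two ht, cnt_cons_of_head_ne ht, cnt_self, Nat.cast_one,
    xlog_one] at h3
  rw [← List.cons_append, ← List.replicate_succ, cnt_replicate_add_two ht (k + 1)] at h3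
  simp only [Finset.sum_const, Finset.card_range, nsmul_eq_mul]
  push_cast
  rw [show (k : ℝ) + 1 + 1 = k + 2 by ring]
  rw [show k + 1 + 2 = k + 3 by ring] at h3
  linear_combination h3

lemma logSum_two_replicate {c : Bool} {t : List Bool} (ht : t.head? ≠ some c) (k : ℕ) :
    logSum 2 (List.replicate k c ++ t) = logSum 2 t + 2 * k * logSum 1 t +
      (k + 2 * t.length + 1) * xlog (k + 1) + xlog ((k + 2).choose 2) +
      (xlog (k + chain c t) - xlog (chain c t)) := by
  induction k with
  | zero => simp
  | succ k ih =>
    rw [logSum_two_replicate_succ ht, ih, show k + 1 + 2 = k + 3 by ring]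
    push_cast
    rw [show (k : ℝ) + 1 + 1 = k + 2 by ring]
    ring

/-! ### Merging the first two runs -/

/-- Two spreading steps, with lower endpoints `A` and then `B`. The sums agree because the
triangular numbers of `A - 1` and `B - 1` plus `A * B` give that of `A + B - 1`. -/
lemma xlog_triangle_le {A B : ℝ} (hA : 1 ≤ A) (hB : 1 ≤ B) :
    xlog (A * (A + 1) / 2) + xlog (B * (B + 1) / 2) + xlog (A * B) ≤
      xlog ((A + B) * (A + B - 1) / 2) + xlog A + xlog B := by
  have h1 : A ≤ A * B := by nlinarith
  have h2 : A ≤ A * (A + 1) / 2 := by nlinarith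
  have h3 : B ≤ B * (B + 1) / 2 := by nlinarith
  have h4 : B ≤ A * B := by nlinarith
  have h5 := xlog_add_le (u := A * B) (by linarith) h1 h2
  have h6 := xlog_add_le (u := A * B + A * (A + 1) / 2 - A) (p := B) (by linarith)
    (by linarith) h3
  rw [show A * B + A * (A + 1) / 2 - A + B * (B + 1) / 2 - B = (A + B) * (A + B - 1) / 2 by
    ring] at h6
  linarith

lemma logSum_two_lt_of_merge {c : Bool} {t : List Bool} (ht : t.head? ≠ some (!c)) (a b : ℕ) :
    logSum 2 (List.replicate (a + 1) c ++ (List.replicate (b + 1) (!c) ++ t)) <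
      logSum 2 (List.replicate (a + 1 + (b + 1)) (!c) ++ t) := by
  have ht' : (List.replicate (b + 1) (!c) ++ t).head? ≠ some c := by
    simp [List.replicate_succ]
  rw [logSum_two_replicate ht', logSum_two_replicate ht, logSum_two_replicate ht,
    logSum_one_replicate ht]
  simp only [Nat.cast_choose_two, List.length_append, List.length_replicate]
  push_cast
  have hc : (chain c (List.replicate (b + 1) (!c) ++ t) : ℝ) ≤ b + 1 + chain (!c) t := by
    exact_mod_cast chain_le ht b
  have hc0 : (0 : ℝ) ≤ chain c (List.replicate (b + 1) (!c) ++ t) := Nat.cast_nonneg _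
  generalize (chain c (List.replicate (b + 1) (!c) ++ t) : ℝ) = θ at hc hc0 ⊢
  generalize (chain (!c) t : ℝ) = θ' at hc ⊢
  have ha : (0 : ℝ) ≤ a := Nat.cast_nonneg _
  have hb : (0 : ℝ) ≤ b := Nat.cast_nonneg _
  have hr : (0 : ℝ) ≤ t.length := Nat.cast_nonneg _
  generalize (a : ℝ) = a at *
  generalize (b : ℝ) = b at *
  generalize (t.length : ℝ) = r at *
  -- `h1` treats the binomial terms, `h2` the `xlog` of run length plus one, and `h3` the `chain`
  -- terms, where `chain_le` supplies the lower-endpoint condition.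
  have h1 := xlog_triangle_le (A := a + 1 + 1) (B := b + 1 + 1) (by linarith) (by linarith)
  have h2 := xlog_add_lt (u := a + 1 + 1) (v := b + 1 + 1) (p := 1) (by norm_num)
    (by linarith) (by linarith)
  have h3 := xlog_add_le (u := a + 1 + θ) (v := b + 1 + θ') hc0 (by linarith) hc
  -- Expanding `xlog (A * B)` equalizes the coefficients left on `xlog A` and `xlog B`: both become
  -- `a + b + 3 + 2 * r`, the factor scaling `h2`.
  rw [xlog_mul (by linarith)] at h1
  rw [show a + 1 + θ + (b + 1 + θ') - θ = a + 1 + (b + 1) + θ' by ring] at h3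
  rw [xlog_one, add_zero, show a + 1 + 1 + (b + 1 + 1) - 1 = a + 1 + (b + 1) + 1 by ring] at h2
  rw [show a + 1 + 1 + (b + 1 + 1) - 1 = a + 1 + (b + 1) + 1 by ring,
    show a + 1 + 1 + (b + 1 + 1) = a + 1 + (b + 1) + 2 by ring] at h1
  have e1 : (a + 1 + 2) * (a + 1 + 2 - 1) / 2 = (a + 1 + 1) * (a + 1 + 1 + 1) / 2 := by ring
  have e2 : (b + 1 + 2) * (b + 1 + 2 - 1) / 2 = (b + 1 + 1) * (b + 1 + 1 + 1) / 2 := by ring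
  have e3 : (a + 1 + (b + 1) + 2) * (a + 1 + (b + 1) + 2 - 1) / 2 =
      (a + 1 + (b + 1) + 2) * (a + 1 + (b + 1) + 1) / 2 := by ring
  rw [e1, e2, e3]
  have h4 := mul_lt_mul_of_pos_left h2 (show 0 < a + b + 3 + 2 * r by linarith)
  linarith

lemma logSum_two_replicate_eq (k : ℕ) (c d : Bool) :
    logSum 2 (List.replicate k c) = logSum 2 (List.replicate k d) := by
  have hc := logSum_two_replicate (c := c) (t := []) (by simp) k
  have hd := logSum_two_replicate (c := d) (t := []) (by simp) k
  simp only [List.append_nil, chain, cnt_nil_left] at hc hd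
  rw [hc, hd]

/-! ### Entropy in terms of `logSum 2` -/

lemma entropy_eq (x : List Bool) :
    entropy (x.length + 2) x =
      (Real.log (totalMasks (x.length + 2) x.length) -
        logSum 2 x / totalMasks (x.length + 2) x.length) / Real.log 2 := by
  have hμ : 0 < totalMasks (x.length + 2) x.length :=
    Nat.mul_pos (Nat.choose_pos (by omega)) (by positivity)
  have hsum : sumStr (x.length + 2) (fun y => (cnt x y : ℝ)) =
      totalMasks (x.length + 2) x.length := by
    have h := sumStr_cnt (x.length + 2) x
    apply mul_left_cancel₀ (show (2 : ℝ) ^ x.length ≠ 0 by positivity)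
    rw [h, totalMasks, Nat.add_sub_cancel_left, pow_add]
    push_cast
    ring
  have hμ' : (0 : ℝ) < totalMasks (x.length + 2) x.length := by exact_mod_cast hμ
  have hsub : ∑ y ∈ uncertaintySet (x.length + 2) x, prob x y * Real.logb 2 (prob x y) =
      ∑ y : Fin (x.length + 2) → Bool, prob x y * Real.logb 2 (prob x y) := by
    apply Finset.sum_subset (Finset.subset_univ _)
    intro y _ hy
    have h0 : weight x y = 0 := by
      simp only [uncertaintySet, Finset.mem_filter, Finset.mem_univ, true_and, not_exists] at hy
      rw [weight, Finset.card_eq_zero, Finset.filter_eq_empty_iff]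
      exact fun π _ => hy π
    simp [prob, h0]
  rw [entropy, hsub]
  simp only [prob, weight_eq_cnt]
  rw [sum_ofFn (x.length + 2) (fun y => (cnt x y : ℝ) / totalMasks (x.length + 2) x.length *
    Real.logb 2 ((cnt x y : ℝ) / totalMasks (x.length + 2) x.length))]
  generalize (totalMasks (x.length + 2) x.length : ℝ) = M at *
  have hterm : ∀ y, y.length = x.length + 2 →
      (cnt x y : ℝ) / M * Real.logb 2 ((cnt x y : ℝ) / M) =
      (xlog (cnt x y) - cnt x y * Real.log M) * (1 / (M * Real.log 2)) := by
    intro y _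
    rcases eq_or_ne (cnt x y : ℝ) 0 with h | h
    · simp [h]
    · rw [Real.logb, Real.log_div h hμ'.ne', xlog]
      field_simp
  rw [sumStr_congr hterm, sumStr_mul, sumStr_sub, sumStr_mul, hsum]
  have hlog : Real.log 2 ≠ 0 := (Real.log_pos one_lt_two).ne'
  rw [logSum]
  field_simp
  ring

lemma entropy_lt_iff {x z : List Bool} (h : x.length = z.length) :
    entropy (x.length + 2) x < entropy (x.length + 2) z ↔ logSum 2 z < logSum 2 x := by
  have hμ : (0 : ℝ) < totalMasks (z.length + 2) z.length := by
    exact_mod_cast Nat.mul_pos (Nat.choose_pos (by omega)) (by positivity)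
  rw [entropy_eq x, h, entropy_eq z, div_lt_div_iff_of_pos_right (Real.log_pos one_lt_two),
    sub_lt_sub_iff_left, div_lt_div_iff_of_pos_right hμ]

/-! ### Run decomposition and iterated merging -/

lemma exists_eq_replicate_append (c : Bool) (x : List Bool) :
    ∃ k t, t.head? ≠ some c ∧ c :: x = List.replicate (k + 1) c ++ t := by
  induction x with
  | nil => exact ⟨0, [], by simp, rfl⟩
  | cons d x ih =>
    obtain ⟨k, t, ht, h⟩ := ih
    rcases eq_or_ne d c with rfl | hd
    · exact ⟨k + 1, t, ht, by rw [h, List.replicate_succ (n := k + 1)]; rfl⟩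
    · exact ⟨0, d :: x, by simpa using hd, rfl⟩

@[simp] lemma runLengths_nil : runLengths [] = [] := by simp [runLengths]

lemma runLengths_replicate_append {c : Bool} {t : List Bool} (ht : t.head? ≠ some c) (k : ℕ) :
    runLengths (List.replicate (k + 1) c ++ t) = (k + 1) :: runLengths t := by
  have h : (List.replicate (k + 1) c).splitBy (fun a b => a == b) =
      [List.replicate (k + 1) c] := by
    apply List.splitBy_of_isChain (by simp [List.replicate_succ])
    exact List.isChain_replicate_of_rel _ (by simp)
  rw [runLengths, List.splitBy_append, h]
  · simp [runLengths]
  · intro x hx y hy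
    obtain rfl : x = c := by simpa using List.eq_of_mem_replicate (List.mem_of_mem_getLast? hx)
    rw [beq_eq_false_iff_ne]
    rintro rfl
    exact ht hy

lemma ofRuns_runLengths (c : Bool) (t : List Bool) (ht : t.head? ≠ some (!c)) :
    ofRuns c (runLengths t) = t := by
  induction hn : t.length using Nat.strong_induction_on generalizing c t with
  | _ n ih =>
    cases t with
    | nil => simp [ofRuns]
    | cons d t =>
      obtain rfl : d = c := by cases c <;> cases d <;> simp at ht ⊢
      obtain ⟨k, u, hu, h⟩ := exists_eq_replicate_append d t
      rw [h, List.length_append, List.length_replicate] at hn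
      rw [h, runLengths_replicate_append hu, ofRuns, ih u.length (by omega) _ u (by simpa) rfl]

lemma eq_replicate_or_exists_runs (x : List Bool) :
    (runLengths x).length ≤ 1 ∧ (∃ c, x = List.replicate x.length c) ∨
    ∃ c a b t, t.head? ≠ some (!c) ∧
      x = List.replicate (a + 1) c ++ (List.replicate (b + 1) (!c) ++ t) := by
  cases x with
  | nil => exact Or.inl ⟨by simp, true, rfl⟩
  | cons c x =>
    obtain ⟨k, t, ht, h⟩ := exists_eq_replicate_append c x
    rw [h]
    cases t with
    | nil => exact Or.inl ⟨by rw [runLengths_replicate_append ht]; simp, c, by simp⟩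
    | cons d t =>
      obtain rfl : d = !c := by cases c <;> cases d <;> simp at ht ⊢
      obtain ⟨b, u, hu, h'⟩ := exists_eq_replicate_append (!c) t
      exact Or.inr ⟨c, k, b, u, hu, by rw [h']⟩

lemma merge_replicate_append {c : Bool} {t : List Bool} (ht : t.head? ≠ some (!c)) (a b : ℕ) :
    merge (List.replicate (a + 1) c ++ (List.replicate (b + 1) (!c) ++ t)) =
      List.replicate (a + 1 + (b + 1)) (!c) ++ t := by
  have h : runLengths (List.replicate (a + 1) c ++ (List.replicate (b + 1) (!c) ++ t)) =
      (a + 1) :: (b + 1) :: runLengths t := by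
    rw [runLengths_replicate_append (by simp [List.replicate_succ]),
      runLengths_replicate_append ht]
  rw [List.replicate_succ, List.cons_append] at h ⊢
  simp only [merge, h, ofRuns, Bool.not_not]
  rw [ofRuns_runLengths c t ht]

lemma eq_replicate_or_logSum_two_lt (x : List Bool) (d : Bool) :
    (∃ c, x = List.replicate x.length c) ∨
      logSum 2 x < logSum 2 (List.replicate x.length d) := by
  induction hn : (runLengths x).length using Nat.strong_induction_on generalizing x with
  | _ n ih =>
    rcases eq_replicate_or_exists_runs x with h | ⟨c, a, b, t, ht, rfl⟩
    · exact Or.inl h.2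
    · right
      rw [runLengths_replicate_append (by simp [List.replicate_succ]),
        runLengths_replicate_append ht] at hn
      have h1 := logSum_two_lt_of_merge ht a b
      have hl : (List.replicate (a + 1) c ++ (List.replicate (b + 1) (!c) ++ t)).length =
        (List.replicate (a + 1 + (b + 1)) (!c) ++ t).length := by simp; ring
      rw [hl]
      rcases ih _ (by
        rw [show a + 1 + (b + 1) = (a + 1 + b) + 1 by ring, runLengths_replicate_append ht, ← hn]
        simp) (List.replicate (a + 1 + (b + 1)) (!c) ++ t) rfl with ⟨e, he⟩ | h2
      · refine h1.trans_eq ?_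
        -- Merging may end at the constant string of the other bit, which has the same sum.
        rw [logSum_two_replicate_eq _ d e, ← he]
      · exact h1.trans h2

end Subseq

theorem mainTheorem2 (n : ℕ) (x : List Bool) (hx : x.length + 2 = n) :
    (1 < (Subseq.runLengths x).length →
      Subseq.entropy n (Subseq.merge x) < Subseq.entropy n x) ∧
    ∀ b : Bool,
      Subseq.entropy n (List.replicate x.length b) ≤ Subseq.entropy n x ∧
      (Subseq.entropy n x = Subseq.entropy n (List.replicate x.length b) ↔
        x = List.replicate x.length false ∨ x = List.replicate x.length true) := by
  subst hx
  constructor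
  · intro h
    rcases Subseq.eq_replicate_or_exists_runs x with h' | ⟨c, a, b, t, ht, rfl⟩
    · omega
    · have hl : (List.replicate (a + 1 + (b + 1)) (!c) ++ t).length =
          (List.replicate (a + 1) c ++ (List.replicate (b + 1) (!c) ++ t)).length := by
        simp; ring
      rw [Subseq.merge_replicate_append ht, ← hl, Subseq.entropy_lt_iff hl]
      exact Subseq.logSum_two_lt_of_merge ht a b
  · intro b
    have hconst : ∀ c, x = List.replicate x.length c →
        Subseq.entropy (x.length + 2) x =
          Subseq.entropy (x.length + 2) (List.replicate x.length b) := by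
      intro c hc
      have hb := Subseq.entropy_eq (List.replicate x.length b)
      rw [List.length_replicate] at hb
      rw [hb, Subseq.entropy_eq, Subseq.logSum_two_replicate_eq _ b c, ← hc]
    have hlt : (∃ c, x = List.replicate x.length c) ∨
        Subseq.entropy (x.length + 2) (List.replicate x.length b) <
          Subseq.entropy (x.length + 2) x := by
      refine (Subseq.eq_replicate_or_logSum_two_lt x b).imp_right fun h => ?_
      have := (Subseq.entropy_lt_iff (x := List.replicate x.length b) (z := x) (by simp)).2 h
      rwa [List.length_replicate] at this
    refine ⟨?_, fun h => ?_, ?_⟩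
    · rcases hlt with ⟨c, hc⟩ | h
      · exact (hconst c hc).ge
      · exact h.le
    · rcases hlt with ⟨c, hc⟩ | h'
      · cases c
        · exact Or.inl hc
        · exact Or.inr hc
      · exact absurd h h'.ne'
    · rintro (h | h)
      · exact hconst _ h
      · exact hconst _ h
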